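/- Let $n$ and $m$ be nonnegative integers with $n \ge 2m$. Let $\mathcal I_n(321)$ be the set of $321$-avoiding involutions of $\{1,\dots,n\}$, that is, of permutations $\pi$ of $\{1,\dots,n\}$ with $\pi=\pi^{-1}$ for which there are no $i<j<k$ with $\pi(i)>\pi(j)>\pi(k)$. For such $\pi$ let $\operatorname{maj}(\pi)$ denote its major index, the sum of all $i$ with $1\le i<n$ and $\pi(i)>\pi(i+1)$. Then $$\left|\{\pi\in\mathcal I_n(321):\operatorname{maj}(\pi)=m\}\right|=p(m),$$ where $p(m)$ is the number of integer partitions of $m$ (with $p(0)=1$). -/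

import Mathlib

namespace PermStat

/-- The permutation `π` of `n` letters is `321`-avoiding: there are no positions `i < j < k`
with `π i > π j > π k`. -/
def Avoids321 {n : ℕ} (π : Equiv.Perm (Fin n)) : Prop :=
  ¬ ∃ i j k : Fin n, i < j ∧ j < k ∧ π i > π j ∧ π j > π k

/-- The set of descent positions of `π`, as a subset of `{1, …, n - 1}`. The letters of `Fin n` are
numbered from `0`, so that `i : Fin n` stands for the position `i + 1` of `{1, …, n}`. -/
def Des {n : ℕ} (π : Equiv.Perm (Fin n)) : Finset ℕ :=
  (Finset.univ.filter fun i : Fin n => ∃ h : (i : ℕ) + 1 < n, π i > π ⟨(i : ℕ) + 1, h⟩).image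
    fun i : Fin n => (i : ℕ) + 1

/-- The major index of `π`: the sum of its descent positions. -/
def maj {n : ℕ} (π : Equiv.Perm (Fin n)) : ℕ :=
  ∑ i ∈ Des π, i

/-- The set of `321`-avoiding involutions of `n` letters, where a permutation is an
involution if it equals its inverse (the identity included). -/
def involutions321 (n : ℕ) : Set (Equiv.Perm (Fin n)) :=
  {π | π = π⁻¹ ∧ Avoids321 π}

end PermStat

namespace PermStat

open Finset Polynomial

/-! Call a position an opener if π moves it up and a closer if π moves it down. A 321-avoiding
involution increases on its openers and on the remaining positions, and no pair crosses a fixed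
point. Hence the i-th opener is paired with the i-th closer, and π amounts to a ballot word with
fixed letters only at height 0 (`IsInvolution321.isBallot`, `IsBallot.isInvolution321_matching`).
Descents are exactly the places where an opener is directly followed by a closer
(`map_succ_lt_iff`), so `maj` becomes `peakSum`.

Removing last letters gives a recurrence in length and final height for the generating function of
`peakSum`. Gaussian binomials satisfy the same recurrence (`gauss_three_term`), so at height 0 the
generating function is the Gaussian binomial with sides ⌈n/2⌉ and ⌊n/2⌋ (`ballotGen_eq_gauss`). Its
coefficient at m counts partitions of m in a box with these sides. For n ≥ 2m the box is no
constraint, which leaves p(m). -/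

/-! ### Gaussian binomials. -/

/-- The Gaussian binomial coefficient `[a + b choose b]`, as a polynomial in `X`. -/
noncomputable def gauss : ℕ → ℕ → ℤ[X]
  | 0, _ => 1
  | _ + 1, 0 => 1
  | a + 1, b + 1 => gauss (a + 1) b + X ^ (b + 1) * gauss a (b + 1)

@[simp] lemma gauss_zero_left (b : ℕ) : gauss 0 b = 1 := by simp [gauss]

@[simp] lemma gauss_zero_right (a : ℕ) : gauss a 0 = 1 := by cases a <;> simp [gauss]

lemma gauss_succ_succ (a b : ℕ) :
    gauss (a + 1) (b + 1) = gauss (a + 1) b + X ^ (b + 1) * gauss a (b + 1) := by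
  rw [gauss]

/-- The two identities are proved jointly: the second at `a + 1` uses both at `a`, and the first at
`a + 1` then follows by induction on `b` from the second. -/
lemma gauss_absorb (a b : ℕ) :
    (1 - X ^ (a + 1)) * gauss (a + 1) b = (1 - X ^ (a + b + 1)) * gauss a b ∧
      (1 - X ^ (b + 1)) * gauss a (b + 1) = (1 - X ^ (a + b + 1)) * gauss a b := by
  induction a generalizing b with
  | zero =>
    refine ⟨?_, by simp⟩
    induction b with
    | zero => simp
    | succ b ih =>
      rw [gauss_succ_succ, mul_add, ih]
      simp only [gauss_zero_left]
      ring
  | succ a iha =>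
    have right (b : ℕ) : (1 - X ^ (b + 1)) * gauss (a + 1) (b + 1) =
        (1 - X ^ (a + 1 + b + 1)) * gauss (a + 1) b := by
      rw [gauss_succ_succ, mul_add]
      linear_combination X ^ (b + 1) * ((iha b).2 - (iha b).1)
    refine ⟨?_, right b⟩
    induction b with
    | zero => simp
    | succ b ihb =>
      rw [gauss_succ_succ]
      linear_combination ihb - right b

lemma gauss_succ_succ' (a b : ℕ) :
    gauss (a + 1) (b + 1) = gauss a (b + 1) + X ^ (a + 1) * gauss (a + 1) b := by
  rw [gauss_succ_succ]
  linear_combination (gauss_absorb a b).1 - (gauss_absorb a b).2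

lemma gauss_comm (a b : ℕ) : gauss a b = gauss b a := by
  induction a generalizing b with
  | zero => simp
  | succ a ih =>
    induction b with
    | zero => simp
    | succ b ihb => rw [gauss_succ_succ' a b, gauss_succ_succ b a, ihb, ih]

/-! ### Coefficients of Gaussian binomials and partitions. -/

/-- The number of partitions of `m` with all parts at most `b`. -/
def boundedCount (b m : ℕ) : ℕ := #(Nat.Partition.restricted m (· ≤ b))

lemma boundedCount_of_le {b m : ℕ} (h : m ≤ b) :
    boundedCount b m = Fintype.card (Nat.Partition m) := by
  unfold boundedCount Nat.Partition.restricted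
  rw [Finset.filter_true_of_mem, Finset.card_univ]
  intro p _ i hi
  exact (Nat.Partition.le_of_mem_parts hi).trans h

lemma boundedCount_zero (m : ℕ) : boundedCount 0 m = if m = 0 then 1 else 0 := by
  split_ifs with h
  · subst h
    rw [boundedCount_of_le le_rfl]
    simp
  · unfold boundedCount Nat.Partition.restricted
    rw [Finset.card_eq_zero, Finset.filter_eq_empty_iff]
    intro p _ hp
    have h0 : p.parts = 0 := Multiset.eq_zero_of_forall_notMem fun i hi => by
      have := p.parts_pos hi
      have := hp i hi
      omega
    have := p.parts_sum
    simp [h0] at this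
    omega

lemma boundedCount_succ_of_lt {b m : ℕ} (h : m < b + 1) :
    boundedCount (b + 1) m = boundedCount b m := by
  rw [boundedCount_of_le (by omega), boundedCount_of_le (by omega)]

/-- Either no part equals `b + 1`, or one such part can be removed. -/
lemma boundedCount_succ_add (b m : ℕ) :
    boundedCount (b + 1) (m + (b + 1)) =
      boundedCount b (m + (b + 1)) + boundedCount (b + 1) m := by
  unfold boundedCount Nat.Partition.restricted
  rw [← Finset.card_filter_add_card_filter_not (fun p : (m + (b + 1)).Partition => b + 1 ∉ p.parts),
    Finset.filter_filter, Finset.filter_filter]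
  congr 1
  · congr 1
    ext p
    simp only [Finset.mem_filter, Finset.mem_univ, true_and]
    constructor
    · rintro ⟨h1, h2⟩ i hi
      have := h1 i hi
      have : i ≠ b + 1 := fun h => h2 (h ▸ hi)
      omega
    · intro h
      exact ⟨fun i hi => (h i hi).trans (by omega), fun hb => by have := h _ hb; omega⟩
  · symm
    refine Finset.card_bij
      (fun p _ => ⟨(b + 1) ::ₘ p.parts, ?_, by simp [p.parts_sum, add_comm]⟩) ?_ ?_ ?_
    · intro i hi
      rcases Multiset.mem_cons.1 hi with rfl | hi
      · omega
      · exact p.parts_pos hi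
    · intro p hp
      simp only [Finset.mem_filter, Finset.mem_univ, true_and] at hp ⊢
      simpa using hp
    · intro p _ q _ h
      simp only [Nat.Partition.mk.injEq, Multiset.cons_inj_right] at h
      exact Nat.Partition.ext h
    · intro p hp
      simp only [Finset.mem_filter, Finset.mem_univ, true_and, not_not] at hp
      obtain ⟨hp, hb⟩ := hp
      obtain ⟨s, hs⟩ := Multiset.exists_cons_of_mem hb
      have hsum := p.parts_sum
      refine ⟨⟨s, fun {i} hi => p.parts_pos (by simp [hs, hi]), ?_⟩, ?_, ?_⟩
      · rw [hs, Multiset.sum_cons] at hsum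
        omega
      · simp only [Finset.mem_filter, Finset.mem_univ, true_and]
        intro i hi
        exact hp i (by simp [hs, hi])
      · exact Nat.Partition.ext hs.symm

/-- A partition of `m ≤ a` has at most `a` parts, so only the bound on the part size survives. The
recursion of `gauss` matches `boundedCount_succ_add`. -/
lemma coeff_gauss (b : ℕ) : ∀ a m : ℕ, m ≤ a → (gauss a b).coeff m = boundedCount b m := by
  induction b with
  | zero =>
    intro a m _
    rw [gauss_zero_right, boundedCount_zero, coeff_one]
    simp
  | succ b ihb =>
    intro a
    induction a with
    | zero =>
      intro m hm
      obtain rfl : m = 0 := by omega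
      rw [boundedCount_of_le (Nat.zero_le _)]
      simp
    | succ a iha =>
      intro m hm
      rw [gauss_succ_succ, coeff_add, ihb _ _ hm, coeff_X_pow_mul']
      split_ifs with h
      · obtain ⟨k, rfl⟩ := Nat.exists_eq_add_of_le' h
        rw [Nat.add_sub_cancel, iha k (by omega), boundedCount_succ_add]
        push_cast
        rfl
      · rw [boundedCount_succ_of_lt (by omega), add_zero]

lemma coeff_gauss_eq_card_partition {a b m : ℕ} (ha : m ≤ a) (hb : m ≤ b) :
    (gauss a b).coeff m = Fintype.card (Nat.Partition m) := by
  rw [coeff_gauss b a m ha, boundedCount_of_le hb]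

/-! ### Ballot words and removal of the last letter. -/

/-- `O` and `C` are the sets of opening and closing positions in a word of length `n` whose height
never gets negative, is `h` at the end, and is `0` at each position outside `O ∪ C`. -/
structure IsBallot (n h : ℕ) (O C : Finset ℕ) : Prop where
  lt_left : ∀ i ∈ O, i < n
  lt_right : ∀ i ∈ C, i < n
  disj : ∀ i ∈ O, i ∉ C
  count_le : ∀ j < n, Nat.count (· ∈ C) j ≤ Nat.count (· ∈ O) j
  count_eq : ∀ j < n, j ∉ O → j ∉ C → Nat.count (· ∈ C) j = Nat.count (· ∈ O) j
  count_end : Nat.count (· ∈ O) n = Nat.count (· ∈ C) n + h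

lemma count_insert_of_le {n j : ℕ} (s : Finset ℕ) (h : j ≤ n) :
    Nat.count (· ∈ insert n s) j = Nat.count (· ∈ s) j := by
  induction j with
  | zero => simp
  | succ j ih =>
    rw [Nat.count_succ, Nat.count_succ, ih (by omega)]
    have : j ≠ n := by omega
    simp [this]

lemma isBallot_insert_left {n h : ℕ} {O C : Finset ℕ} (hO : n ∉ O) (hC : n ∉ C) :
    IsBallot (n + 1) h (insert n O) C ↔ ∃ k, h = k + 1 ∧ IsBallot n k O C := by
  constructor
  · intro H
    have hend := H.count_end
    have hle := H.count_le n (by omega)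
    rw [Nat.count_succ, Nat.count_succ] at hend
    rw [count_insert_of_le _ le_rfl] at hend hle
    simp only [mem_insert_self, if_true, hC, if_false] at hend
    refine ⟨h - 1, by omega, fun i hi => ?_, fun i hi => ?_, fun i hi => ?_, fun j hj => ?_,
      fun j hj h1 h2 => ?_, by omega⟩
    · have := H.lt_left i (by simp [hi])
      have : i ≠ n := fun h => hO (h ▸ hi)
      omega
    · have := H.lt_right i hi
      have : i ≠ n := fun h => hC (h ▸ hi)
      omega
    · exact H.disj i (by simp [hi])
    · rw [← count_insert_of_le O hj.le]
      exact H.count_le j (by omega)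
    · rw [← count_insert_of_le O hj.le]
      exact H.count_eq j (by omega) (by simp [h1, hj.ne]) h2
  · rintro ⟨k, rfl, H⟩
    refine ⟨fun i hi => ?_, fun i hi => ?_, fun i hi => ?_, fun j hj => ?_,
      fun j hj h1 h2 => ?_, ?_⟩
    · rcases mem_insert.1 hi with rfl | hi
      · omega
      · exact (H.lt_left i hi).trans (by omega)
    · exact (H.lt_right i hi).trans (by omega)
    · rcases mem_insert.1 hi with rfl | hi
      · exact hC
      · exact H.disj i hi
    · rw [count_insert_of_le O (by omega)]
      rcases Nat.lt_succ_iff_lt_or_eq.1 hj with hj | rfl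
      · exact H.count_le j hj
      · exact H.count_end ▸ Nat.le_add_right _ _
    · rw [count_insert_of_le O (by omega)]
      simp only [mem_insert, not_or] at h1
      exact H.count_eq j (by omega) h1.2 h2
    · have := H.count_end
      rw [Nat.count_succ, Nat.count_succ, count_insert_of_le _ le_rfl]
      simp only [mem_insert_self, if_true, hC, if_false]
      omega

lemma isBallot_insert_right {n h : ℕ} {O C : Finset ℕ} (hO : n ∉ O) (hC : n ∉ C) :
    IsBallot (n + 1) h O (insert n C) ↔ IsBallot n (h + 1) O C := by
  constructor
  · intro H
    have hend := H.count_end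
    rw [Nat.count_succ, Nat.count_succ] at hend
    rw [count_insert_of_le _ le_rfl] at hend
    simp only [mem_insert_self, if_true, hO, if_false] at hend
    refine ⟨fun i hi => ?_, fun i hi => ?_, fun i hi hi' => ?_, fun j hj => ?_,
      fun j hj h1 h2 => ?_, by omega⟩
    · have := H.lt_left i hi
      have : i ≠ n := fun h => hO (h ▸ hi)
      omega
    · have := H.lt_right i (by simp [hi])
      have : i ≠ n := fun h => hC (h ▸ hi)
      omega
    · exact H.disj i hi (by simp [hi'])
    · rw [← count_insert_of_le C hj.le]
      exact H.count_le j (by omega)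
    · rw [← count_insert_of_le C hj.le]
      exact H.count_eq j (by omega) h1 (by simp [h2, hj.ne])
  · intro H
    refine ⟨fun i hi => ?_, fun i hi => ?_, fun i hi => ?_, fun j hj => ?_,
      fun j hj h1 h2 => ?_, ?_⟩
    · exact (H.lt_left i hi).trans (by omega)
    · rcases mem_insert.1 hi with rfl | hi
      · omega
      · exact (H.lt_right i hi).trans (by omega)
    · have := H.lt_left i hi
      simp [H.disj i hi, this.ne]
    · rw [count_insert_of_le C (by omega)]
      rcases Nat.lt_succ_iff_lt_or_eq.1 hj with hj | rfl
      · exact H.count_le j hj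
      · exact H.count_end ▸ Nat.le_add_right _ _
    · rw [count_insert_of_le C (by omega)]
      simp only [mem_insert, not_or] at h2
      exact H.count_eq j (by omega) h1 h2.2
    · have := H.count_end
      rw [Nat.count_succ, Nat.count_succ, count_insert_of_le _ le_rfl]
      simp only [mem_insert_self, if_true, hO, if_false]
      omega

lemma isBallot_succ_of_notMem {n h : ℕ} {O C : Finset ℕ} (hO : n ∉ O) (hC : n ∉ C) :
    IsBallot (n + 1) h O C ↔ h = 0 ∧ IsBallot n 0 O C := by
  constructor
  · intro H
    have hend := H.count_end
    have heq := H.count_eq n (by omega) hO hC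
    rw [Nat.count_succ, Nat.count_succ] at hend
    simp only [hC, hO, if_false] at hend
    refine ⟨by omega, fun i hi => ?_, fun i hi => ?_, H.disj, fun j hj => H.count_le j (by omega),
      fun j hj => H.count_eq j (by omega), heq.symm⟩
    · have := H.lt_left i hi
      have : i ≠ n := fun h => hO (h ▸ hi)
      omega
    · have := H.lt_right i hi
      have : i ≠ n := fun h => hC (h ▸ hi)
      omega
  · rintro ⟨rfl, H⟩
    have hend := H.count_end
    refine ⟨fun i hi => (H.lt_left i hi).trans (by omega),
      fun i hi => (H.lt_right i hi).trans (by omega), H.disj, fun j hj => ?_,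
      fun j hj h1 h2 => ?_, ?_⟩
    · rcases Nat.lt_succ_iff_lt_or_eq.1 hj with hj | rfl
      · exact H.count_le j hj
      · omega
    · rcases Nat.lt_succ_iff_lt_or_eq.1 hj with hj | rfl
      · exact H.count_eq j hj h1 h2
      · omega
    · rw [Nat.count_succ, Nat.count_succ]
      simpa [hO, hC] using hend

open Classical in
/-- The finite set of all pairs satisfying `IsBallot n h`. -/
noncomputable def ballots (n h : ℕ) : Finset (Finset ℕ × Finset ℕ) :=
  {x ∈ (range n).powerset ×ˢ (range n).powerset | IsBallot n h x.1 x.2}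

lemma mem_ballots {n h : ℕ} {x : Finset ℕ × Finset ℕ} :
    x ∈ ballots n h ↔ IsBallot n h x.1 x.2 := by
  simp only [ballots, mem_filter, mem_product, mem_powerset, and_iff_right_iff_imp]
  exact fun H => ⟨fun i hi => mem_range.2 (H.lt_left i hi),
    fun i hi => mem_range.2 (H.lt_right i hi)⟩

lemma IsBallot.notMem_left {n h : ℕ} {O C : Finset ℕ} (H : IsBallot n h O C) : n ∉ O :=
  fun h => (H.lt_left n h).false

lemma IsBallot.notMem_right {n h : ℕ} {O C : Finset ℕ} (H : IsBallot n h O C) : n ∉ C :=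
  fun h => (H.lt_right n h).false

/-! ### Generating function of the peak sum. -/

/-- The sum of the elements of `C` that are preceded by an element of `O`. -/
def peakSum (O C : Finset ℕ) : ℕ := ∑ i ∈ C with 0 < i ∧ i - 1 ∈ O, i

/-- The generating function of `peakSum` over `ballots n h`. -/
noncomputable def ballotGen (n h : ℕ) : ℤ[X] := ∑ x ∈ ballots n h, X ^ peakSum x.1 x.2

lemma peakSum_insert_left {n : ℕ} {O C : Finset ℕ} (hC : ∀ i ∈ C, i < n) :
    peakSum (insert n O) C = peakSum O C := by
  unfold peakSum
  congr 1
  refine filter_congr fun i hi => ?_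
  have : i - 1 ≠ n := by have := hC i hi; omega
  simp [this]

lemma peakSum_insert_right {n : ℕ} {O C : Finset ℕ} (hC : n ∉ C) :
    peakSum O (insert n C) = peakSum O C + if 0 < n ∧ n - 1 ∈ O then n else 0 := by
  unfold peakSum
  rw [filter_insert]
  split_ifs with h
  · rw [sum_insert (by simp [hC]), add_comm]
  · simp

/-- The part of `ballotGen (n + 1) (h + 1)` contributed by pairs with `n ∈ O`. -/
lemma sum_ballots_mem_left (n h : ℕ) :
    ∑ x ∈ ballots (n + 1) (h + 1) with n ∈ x.1, (X : ℤ[X]) ^ peakSum x.1 x.2 =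
      ballotGen n h := by
  unfold ballotGen
  symm
  refine sum_bij (fun x _ => (insert n x.1, x.2)) ?_ ?_ ?_ ?_
  · intro x hx
    have hx := mem_ballots.1 hx
    refine mem_filter.2 ⟨mem_ballots.2 ?_, by simp⟩
    exact (isBallot_insert_left hx.notMem_left hx.notMem_right).2 ⟨h, rfl, hx⟩
  · intro x hx y hy hxy
    have hx := (mem_ballots.1 hx).notMem_left
    have hy := (mem_ballots.1 hy).notMem_left
    simp only [Prod.mk.injEq] at hxy
    refine Prod.ext ?_ hxy.2
    rw [← erase_insert hx, hxy.1, erase_insert hy]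
  · intro x hx
    obtain ⟨hx, hn⟩ := mem_filter.1 hx
    have hx := mem_ballots.1 hx
    refine ⟨(x.1.erase n, x.2), ?_, by simp [insert_erase hn]⟩
    have hC := hx.disj n hn
    rw [← insert_erase hn, isBallot_insert_left (by simp) hC] at hx
    obtain ⟨k, hk, hx⟩ := hx
    obtain rfl : h = k := by omega
    exact mem_ballots.2 hx
  · intro x hx
    rw [peakSum_insert_left (mem_ballots.1 hx).lt_right]

lemma sum_ballots_mem_right (n h : ℕ) :
    ∑ x ∈ ballots (n + 1) h with n ∈ x.2, (X : ℤ[X]) ^ peakSum x.1 x.2 =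
      ∑ x ∈ ballots n (h + 1),
        X ^ (peakSum x.1 x.2 + if 0 < n ∧ n - 1 ∈ x.1 then n else 0) := by
  symm
  refine sum_bij (fun x _ => (x.1, insert n x.2)) ?_ ?_ ?_ ?_
  · intro x hx
    have hx := mem_ballots.1 hx
    refine mem_filter.2 ⟨mem_ballots.2 ?_, by simp⟩
    exact (isBallot_insert_right hx.notMem_left hx.notMem_right).2 hx
  · intro x hx y hy hxy
    have hx := (mem_ballots.1 hx).notMem_right
    have hy := (mem_ballots.1 hy).notMem_right
    simp only [Prod.mk.injEq] at hxy
    refine Prod.ext hxy.1 ?_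
    rw [← erase_insert hx, hxy.2, erase_insert hy]
  · intro x hx
    obtain ⟨hx, hn⟩ := mem_filter.1 hx
    have hx := mem_ballots.1 hx
    refine ⟨(x.1, x.2.erase n), ?_, by simp [insert_erase hn]⟩
    have hO : n ∉ x.1 := fun h => hx.disj n h hn
    rw [← insert_erase hn, isBallot_insert_right hO (by simp)] at hx
    exact mem_ballots.2 hx
  · intro x hx
    rw [peakSum_insert_right (mem_ballots.1 hx).notMem_right]

/-- Removing the final closer loses weight `n + 1` exactly when position `n` is an opener. The words
with that opener contribute `ballotGen n h`, and for them the factor 1 is replaced by `X ^ (n + 1)`.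
-/
lemma sum_ballots_mem_right_succ (n h : ℕ) :
    ∑ x ∈ ballots (n + 2) h with n + 1 ∈ x.2, (X : ℤ[X]) ^ peakSum x.1 x.2 =
      ballotGen (n + 1) (h + 1) - (1 - X ^ (n + 1)) * ballotGen n h := by
  rw [sum_ballots_mem_right, ← sum_ballots_mem_left n h, ballotGen, mul_sum, sum_filter,
    ← sum_sub_distrib]
  refine sum_congr rfl fun x _ => ?_
  by_cases hn : n ∈ x.1
  · simp only [Nat.succ_pos, Nat.add_sub_cancel, hn, and_self, if_true]
    ring
  · simp [hn]

/-- At positive height the last letter cannot be fixed. -/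
lemma filter_ballots_succ_notMem_right (n h : ℕ) :
    {x ∈ ballots (n + 1) (h + 1) | n ∉ x.2} = {x ∈ ballots (n + 1) (h + 1) | n ∈ x.1} := by
  refine filter_congr fun x hx => ?_
  have hx := mem_ballots.1 hx
  refine ⟨fun hC => ?_, hx.disj n⟩
  by_contra hO
  simp [isBallot_succ_of_notMem hO hC] at hx

lemma filter_ballots_zero_notMem_right (n : ℕ) :
    {x ∈ ballots (n + 1) 0 | n ∉ x.2} = ballots n 0 := by
  ext x
  simp only [mem_filter, mem_ballots]
  constructor
  · rintro ⟨H, hC⟩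
    by_cases hO : n ∈ x.1
    · rw [← insert_erase hO, isBallot_insert_left (by simp) hC] at H
      simp at H
    · exact ((isBallot_succ_of_notMem hO hC).1 H).2
  · intro H
    exact ⟨(isBallot_succ_of_notMem H.notMem_left H.notMem_right).2 ⟨rfl, H⟩, H.notMem_right⟩

lemma ballotGen_succ_succ (n h : ℕ) :
    ballotGen (n + 2) (h + 1) = ballotGen (n + 1) h + ballotGen (n + 1) (h + 2) -
      (1 - X ^ (n + 1)) * ballotGen n (h + 1) := by
  rw [ballotGen, ← sum_filter_add_sum_filter_not _ (fun x => n + 1 ∈ x.2),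
    filter_ballots_succ_notMem_right, sum_ballots_mem_right_succ, sum_ballots_mem_left]
  ring

/-- A final fixed letter supplies the term that a step up from height -1 would give in
`ballotGen_succ_succ`. -/
lemma ballotGen_succ_zero (n : ℕ) :
    ballotGen (n + 2) 0 = ballotGen (n + 1) 0 + ballotGen (n + 1) 1 -
      (1 - X ^ (n + 1)) * ballotGen n 0 := by
  rw [ballotGen, ← sum_filter_add_sum_filter_not _ (fun x => n + 1 ∈ x.2),
    filter_ballots_zero_notMem_right, sum_ballots_mem_right_succ]
  simp only [ballotGen]
  ring

lemma ballots_eq_empty {n h : ℕ} (hn : n < h) : ballots n h = ∅ := by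
  refine eq_empty_of_forall_notMem fun x hx => ?_
  have := (mem_ballots.1 hx).count_end
  have : Nat.count (· ∈ x.1) n ≤ n := Nat.count_le _
  omega

lemma ballots_zero_zero : ballots 0 0 = {(∅, ∅)} := by
  ext x
  rw [mem_ballots, mem_singleton]
  constructor
  · intro H
    refine Prod.ext ?_ ?_
    · exact eq_empty_of_forall_notMem fun i hi => absurd (H.lt_left i hi) (by omega)
    · exact eq_empty_of_forall_notMem fun i hi => absurd (H.lt_right i hi) (by omega)
  · rintro rfl
    constructor <;> simp

lemma ballotGen_eq_zero {n h : ℕ} (hn : n < h) : ballotGen n h = 0 := by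
  simp [ballotGen, ballots_eq_empty hn]

lemma ballotGen_zero_zero : ballotGen 0 0 = 1 := by
  simp [ballotGen, ballots_zero_zero, peakSum]

lemma ballotGen_one_zero : ballotGen 1 0 = 1 := by
  rw [ballotGen, ← sum_filter_add_sum_filter_not _ (fun x => 0 ∈ x.2),
    filter_ballots_zero_notMem_right 0, sum_ballots_mem_right, ballots_eq_empty (by omega),
    ballots_zero_zero]
  simp [peakSum]

lemma ballotGen_one_one : ballotGen 1 1 = 1 := by
  rw [ballotGen, ← sum_filter_add_sum_filter_not _ (fun x => 0 ∈ x.2),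
    filter_ballots_succ_notMem_right 0, sum_ballots_mem_right, ballots_eq_empty (by omega),
    sum_ballots_mem_left, ballotGen_zero_zero]
  simp

lemma gauss_three_term (a b : ℕ) :
    gauss (a + 1) (b + 1) = gauss a (b + 1) + gauss (a + 1) b -
      (1 - X ^ (a + b + 1)) * gauss a b := by
  rw [gauss_succ_succ']
  linear_combination -(gauss_absorb a b).1

/-- The parity correction `e` is needed because fixed letters free `n - h` from being even. -/
lemma ballotGen_eq_gauss (n : ℕ) :
    ∀ k h e : ℕ, e ≤ 1 → n = 2 * k + h + e → ballotGen n h = gauss (k + h + e) k := by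
  induction n using Nat.twoStepInduction with
  | zero =>
    intro k h e _ hn
    obtain ⟨rfl, rfl, rfl⟩ : k = 0 ∧ h = 0 ∧ e = 0 := by omega
    simp [ballotGen_zero_zero]
  | one =>
    intro k h e _ hn
    obtain rfl : k = 0 := by omega
    rw [gauss_zero_right]
    obtain rfl | rfl : h = 0 ∨ h = 1 := by omega
    · exact ballotGen_one_zero
    · exact ballotGen_one_one
  | more n ih ih' =>
    intro k h e he hn
    obtain _ | h := h
    · obtain ⟨k, rfl⟩ : ∃ l, k = l + 1 := ⟨k - 1, by omega⟩
      rw [ballotGen_succ_zero, ih k 0 e he (by omega)]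
      obtain rfl | rfl : e = 0 ∨ e = 1 := by omega
      · rw [ih' k 0 1 le_rfl (by omega), ih' k 1 0 (by omega) (by omega)]
        have := gauss_three_term k k
        -- At height 0 the boundary recurrence fits the three-term identity by symmetry of the
        -- Gaussian binomial.
        rw [gauss_comm k (k + 1)] at this
        rw [show n + 1 = k + k + 1 by omega]
        exact this.symm
      · rw [ih' (k + 1) 0 0 (by omega) (by omega), ih' k 1 1 (by omega) (by omega)]
        rw [show n + 1 = k + 1 + k + 1 by omega]
        exact (gauss_three_term (k + 1) k).symm
    · rw [ballotGen_succ_succ, ih' k h e he (by omega)]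
      obtain _ | k := k
      -- With `k = 0`, both remaining terms have height greater than length.
      · rw [ballotGen_eq_zero (by omega), ballotGen_eq_zero (by omega)]
        simp
      · rw [ih' k (h + 2) e he (by omega), ih k (h + 1) e he (by omega)]
        have := gauss_three_term (k + h + 1 + e) k
        rw [show n + 1 = k + h + 1 + e + k + 1 by omega,
          show k + 1 + (h + 1) + e = k + h + 1 + e + 1 by omega,
          show k + 1 + h + e = k + h + 1 + e by omega,
          show k + (h + 2) + e = k + h + 1 + e + 1 by omega,
          show k + (h + 1) + e = k + h + 1 + e by omega]
        exact this.symm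

/-! ### From 321-avoiding involutions to ballot words. -/

/-- `f` is an involution of `ℕ` that fixes each `a ≥ n` and avoids the pattern `321`. -/
structure IsInvolution321 (n : ℕ) (f : ℕ → ℕ) : Prop where
  invol : ∀ a, f (f a) = a
  fix : ∀ a, n ≤ a → f a = a
  avoid : ∀ i j k, i < j → j < k → f j < f i → f k < f j → False

namespace IsInvolution321

variable {n : ℕ} {f : ℕ → ℕ}

lemma map_lt (H : IsInvolution321 n f) {a : ℕ} (ha : a < n) : f a < n := by
  by_contra h
  have := H.fix (f a) (by omega)
  rw [H.invol] at this
  omega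

lemma injective (H : IsInvolution321 n f) : Function.Injective f :=
  fun a b h => by rw [← H.invol a, h, H.invol]

lemma lt_of_lt_map (H : IsInvolution321 n f) {a : ℕ} (ha : a < f a) : a < n := by
  by_contra h
  have := H.fix a (by omega)
  omega

lemma lt_of_map_lt (H : IsInvolution321 n f) {a : ℕ} (ha : f a < a) : a < n := by
  by_contra h
  have := H.fix a (by omega)
  omega

lemma map_lt_map_of_lt_map (H : IsInvolution321 n f) {i j : ℕ} (hij : i < j) (hj : j < f j) :
    f i < f j := by
  by_contra h
  have hne : f i ≠ f j := fun h => hij.ne (H.injective h)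
  have := H.invol j
  -- The pattern has values `f i > f j > j`.
  exact H.avoid i j (f j) hij hj (by omega) (by omega)

lemma map_lt_map_of_map_le (H : IsInvolution321 n f) {i j : ℕ} (hij : i < j) (hi : f i ≤ i) :
    f i < f j := by
  by_contra h
  have hne : f i ≠ f j := fun h => hij.ne (H.injective h)
  have h1 := H.invol j
  have h2 := H.invol i
  rcases hi.lt_or_eq with hi' | hi'
  · exact H.avoid (f j) (f i) i (by omega) hi' (by omega) (by omega)
  · exact H.avoid (f j) i j (by omega) hij (by omega) (by omega)

lemma map_lt_of_map_eq (H : IsInvolution321 n f) {i a : ℕ} (ha : f a = a) (hi : i < a) :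
    f i < a := by
  by_contra h
  have hne : f i ≠ f a := fun h => hi.ne (H.injective h)
  have h2 := H.invol i
  exact H.avoid i a (f i) hi (by omega) (by omega) (by omega)

/-- A descent cannot start at a non-opener, nor end at an opener or a fixed point, by the three
preceding monotonicity lemmas. -/
lemma map_succ_lt_iff (H : IsInvolution321 n f) (i : ℕ) :
    f (i + 1) < f i ↔ i < f i ∧ f (i + 1) < i + 1 := by
  constructor
  · intro h
    have hi : i < f i := by
      by_contra hi
      have := H.map_lt_map_of_map_le (show i < i + 1 by omega) (by omega)
      omega
    refine ⟨hi, ?_⟩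
    rcases lt_trichotomy (f (i + 1)) (i + 1) with h' | h' | h'
    · exact h'
    · have := H.map_lt_of_map_eq h' (show i < i + 1 by omega)
      omega
    · have := H.map_lt_map_of_lt_map (show i < i + 1 by omega) h'
      omega
  · omega

end IsInvolution321

lemma count_le_count_of_mapsTo {s t : Finset ℕ} {f : ℕ → ℕ} (hf : Function.Injective f) {j k : ℕ}
    (h : ∀ a < j, a ∈ s → f a < k ∧ f a ∈ t) : Nat.count (· ∈ s) j ≤ Nat.count (· ∈ t) k := by
  rw [Nat.count_eq_card_filter_range, Nat.count_eq_card_filter_range]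
  refine card_le_card_of_injOn f (fun a ha => ?_) hf.injOn
  simp only [coe_filter, mem_range, Set.mem_ofPred_eq] at ha ⊢
  exact h a ha.1 ha.2

/-- The positions `a < n` with `a < f a`. -/
def openers (n : ℕ) (f : ℕ → ℕ) : Finset ℕ := {a ∈ range n | a < f a}

/-- The positions `a < n` with `f a < a`. -/
def closers (n : ℕ) (f : ℕ → ℕ) : Finset ℕ := {a ∈ range n | f a < a}

namespace IsInvolution321

variable {n : ℕ} {f : ℕ → ℕ}

lemma mem_openers (H : IsInvolution321 n f) {a : ℕ} : a ∈ openers n f ↔ a < f a := by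
  simpa [openers] using H.lt_of_lt_map

lemma mem_closers (H : IsInvolution321 n f) {a : ℕ} : a ∈ closers n f ↔ f a < a := by
  simpa [closers] using H.lt_of_map_lt

lemma count_closers_le (H : IsInvolution321 n f) (j : ℕ) :
    Nat.count (· ∈ closers n f) j ≤ Nat.count (· ∈ openers n f) j := by
  refine count_le_count_of_mapsTo H.injective fun a ha h => ?_
  rw [H.mem_openers, H.invol]
  have := H.mem_closers.1 h
  exact ⟨by omega, this⟩

lemma count_closers_eq (H : IsInvolution321 n f) {j : ℕ} (hj : ∀ a < j, f a < j) :
    Nat.count (· ∈ closers n f) j = Nat.count (· ∈ openers n f) j := by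
  refine (H.count_closers_le j).antisymm (count_le_count_of_mapsTo H.injective fun a ha h => ?_)
  rw [H.mem_closers, H.invol]
  exact ⟨hj a ha, H.mem_openers.1 h⟩

/-- `f` restricts to a bijection between the closers before `f a` and the openers before `a`. This
makes `f` recoverable from its openers and closers. -/
lemma count_closers_map (H : IsInvolution321 n f) {a : ℕ} (ha : a ∈ openers n f) :
    Nat.count (· ∈ closers n f) (f a) = Nat.count (· ∈ openers n f) a := by
  have ha := H.mem_openers.1 ha
  refine le_antisymm ?_ ?_
  · refine count_le_count_of_mapsTo H.injective fun c hc h => ?_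
    have h := H.mem_closers.1 h
    rw [H.mem_openers, H.invol]
    have := H.map_lt_map_of_map_le hc h.le
    rw [H.invol] at this
    exact ⟨this, h⟩
  · refine count_le_count_of_mapsTo H.injective fun b hb h => ?_
    have h := H.mem_openers.1 h
    rw [H.mem_closers, H.invol]
    exact ⟨H.map_lt_map_of_lt_map hb ha, h⟩

lemma isBallot (H : IsInvolution321 n f) : IsBallot n 0 (openers n f) (closers n f) where
  lt_left _ hi := H.lt_of_lt_map (H.mem_openers.1 hi)
  lt_right _ hi := H.lt_of_map_lt (H.mem_closers.1 hi)
  disj i hi hi' := by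
    have := H.mem_openers.1 hi
    have := H.mem_closers.1 hi'
    omega
  count_le j _ := H.count_closers_le j
  count_eq j _ hO hC := by
    rw [H.mem_openers] at hO
    rw [H.mem_closers] at hC
    exact H.count_closers_eq fun a ha => H.map_lt_of_map_eq (by omega) ha
  count_end := (H.count_closers_eq fun _ ha => H.map_lt ha).symm

lemma map_mem_closers (H : IsInvolution321 n f) {a : ℕ} (ha : a ∈ openers n f) :
    f a ∈ closers n f := by
  rw [H.mem_closers, H.invol]
  exact H.mem_openers.1 ha

lemma map_mem_openers (H : IsInvolution321 n f) {a : ℕ} (ha : a ∈ closers n f) :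
    f a ∈ openers n f := by
  rw [H.mem_openers, H.invol]
  exact H.mem_closers.1 ha

lemma eq_of_openers_eq {g : ℕ → ℕ} (Hf : IsInvolution321 n f) (Hg : IsInvolution321 n g)
    (hO : openers n f = openers n g) (hC : closers n f = closers n g) : f = g := by
  have key : ∀ a ∈ openers n f, f a = g a := fun a ha =>
    Nat.count_injective (p := (· ∈ closers n f)) (Hf.map_mem_closers ha)
      (hC ▸ Hg.map_mem_closers (hO ▸ ha)) (by
        rw [Hf.count_closers_map ha]
        simp only [hC, hO] at ha ⊢
        rw [Hg.count_closers_map ha])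
  funext a
  by_cases h1 : a ∈ openers n f
  · exact key a h1
  by_cases h2 : a ∈ closers n f
  · have := key _ (Hf.map_mem_openers h2)
    rw [Hf.invol] at this
    rw [this, Hg.invol, ← this]
  · have h1' := h1
    have h2' := h2
    rw [hO, Hg.mem_openers] at h1'
    rw [hC, Hg.mem_closers] at h2'
    rw [Hf.mem_openers] at h1
    rw [Hf.mem_closers] at h2
    omega

lemma peakSum_eq (H : IsInvolution321 n f) :
    peakSum (openers n f) (closers n f) = ∑ i ∈ range n with f (i + 1) < f i, (i + 1) := by
  unfold peakSum
  symm
  refine sum_bij (fun i _ => i + 1) ?_ ?_ ?_ ?_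
  · intro i hi
    rw [mem_filter, H.map_succ_lt_iff] at hi
    rw [mem_filter, H.mem_closers, Nat.add_sub_cancel, H.mem_openers]
    exact ⟨hi.2.2, by omega, hi.2.1⟩
  · intro i _ j _ h
    omega
  · intro c hc
    rw [mem_filter, H.mem_closers, H.mem_openers] at hc
    obtain ⟨i, rfl⟩ : ∃ i, c = i + 1 := ⟨c - 1, by omega⟩
    rw [Nat.add_sub_cancel] at hc
    refine ⟨i, ?_, rfl⟩
    rw [mem_filter, H.map_succ_lt_iff, mem_range]
    exact ⟨H.lt_of_lt_map hc.2.2, hc.2.2, hc.1⟩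
  · intro _ _
    rfl

end IsInvolution321

/-! ### From ballot words back to involutions. -/

/-- The involution of `ℕ` that matches the elements of `O` and `C` in order. -/
noncomputable def matching (O C : Finset ℕ) (a : ℕ) : ℕ :=
  if a ∈ O then Nat.nth (· ∈ C) (Nat.count (· ∈ O) a)
  else if a ∈ C then Nat.nth (· ∈ O) (Nat.count (· ∈ C) a)
  else a

namespace IsBallot

variable {n : ℕ} {O C : Finset ℕ}

lemma nth_spec {s : Finset ℕ} {k m : ℕ} (h : k < Nat.count (· ∈ s) m) :
    Nat.nth (· ∈ s) k ∈ s ∧ Nat.count (· ∈ s) (Nat.nth (· ∈ s) k) = k := by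
  have hk := fun hf => h.trans_le (Nat.count_le_card (p := (· ∈ s)) hf m)
  exact ⟨Nat.nth_mem k hk, Nat.count_nth hk⟩

lemma matching_left (H : IsBallot n 0 O C) {a : ℕ} (ha : a ∈ O) :
    matching O C a ∈ C ∧ Nat.count (· ∈ C) (matching O C a) = Nat.count (· ∈ O) a := by
  rw [matching, if_pos ha]
  refine nth_spec (m := n) ?_
  have := H.count_end
  have := Nat.count_strict_mono (p := (· ∈ O)) ha (H.lt_left a ha)
  omega

lemma matching_right (H : IsBallot n 0 O C) {a : ℕ} (ha : a ∈ C) :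
    matching O C a ∈ O ∧ Nat.count (· ∈ O) (matching O C a) = Nat.count (· ∈ C) a := by
  rw [matching, if_neg fun h => H.disj a h ha, if_pos ha]
  refine nth_spec (m := n) ?_
  have := H.count_end
  have := Nat.count_strict_mono (p := (· ∈ C)) ha (H.lt_right a ha)
  omega

lemma matching_of_notMem {a : ℕ} (h1 : a ∉ O) (h2 : a ∉ C) : matching O C a = a := by
  rw [matching, if_neg h1, if_neg h2]

lemma matching_matching (H : IsBallot n 0 O C) (a : ℕ) : matching O C (matching O C a) = a := by
  by_cases h1 : a ∈ O
  · obtain ⟨h, hc⟩ := H.matching_left h1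
    obtain ⟨h', hc'⟩ := H.matching_right h
    exact Nat.count_injective (p := (· ∈ O)) h' h1 (hc'.trans hc)
  by_cases h2 : a ∈ C
  · obtain ⟨h, hc⟩ := H.matching_right h2
    obtain ⟨h', hc'⟩ := H.matching_left h
    exact Nat.count_injective (p := (· ∈ C)) h' h2 (hc'.trans hc)
  · rw [matching_of_notMem h1 h2, matching_of_notMem h1 h2]

lemma lt_matching (H : IsBallot n 0 O C) {a : ℕ} (ha : a ∈ O) : a < matching O C a := by
  obtain ⟨h, hc⟩ := H.matching_left ha
  by_contra hlt
  have hne : matching O C a ≠ a := fun e => H.disj a ha (e ▸ h)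
  -- If the partner came first, then just after it the closers would outnumber the openers, against
  -- the ballot condition.
  have hlt : matching O C a + 1 ≤ a := by omega
  have h1 := H.count_le _ (hlt.trans_lt (H.lt_left a ha))
  have h2 := Nat.count_monotone (· ∈ O) hlt
  rw [Nat.count_succ, if_pos h] at h1
  omega

lemma matching_lt (H : IsBallot n 0 O C) {a : ℕ} (ha : a ∈ C) : matching O C a < a := by
  have := H.lt_matching (H.matching_right ha).1
  rwa [H.matching_matching] at this

lemma lt_matching_iff (H : IsBallot n 0 O C) {a : ℕ} : a < matching O C a ↔ a ∈ O := by
  refine ⟨fun h => ?_, H.lt_matching⟩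
  by_contra h1
  by_cases h2 : a ∈ C
  · exact (H.matching_lt h2).not_gt h
  · rw [matching_of_notMem h1 h2] at h
    exact h.false

lemma matching_lt_iff (H : IsBallot n 0 O C) {a : ℕ} : matching O C a < a ↔ a ∈ C := by
  refine ⟨fun h => ?_, H.matching_lt⟩
  by_contra h2
  by_cases h1 : a ∈ O
  · exact (H.lt_matching h1).not_gt h
  · rw [matching_of_notMem h1 h2] at h
    exact h.false

lemma matching_lt_matching_of_mem (H : IsBallot n 0 O C) {i j : ℕ} (hij : i < j) (hi : i ∈ O)
    (hj : j ∈ O) : matching O C i < matching O C j := by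
  refine Nat.lt_of_count_lt_count (p := (· ∈ C)) ?_
  rw [(H.matching_left hi).2, (H.matching_left hj).2]
  exact Nat.count_strict_mono hi hij

lemma matching_lt_matching_of_notMem (H : IsBallot n 0 O C) {i j : ℕ} (hij : i < j) (hi : i ∉ O)
    (hj : j ∉ O) : matching O C i < matching O C j := by
  by_cases hjC : j ∈ C
  · by_cases hiC : i ∈ C
    · refine Nat.lt_of_count_lt_count (p := (· ∈ O)) ?_
      rw [(H.matching_right hiC).2, (H.matching_right hjC).2]
      exact Nat.count_strict_mono hiC hij
    · rw [matching_of_notMem hi hiC]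
      obtain ⟨h, hc⟩ := H.matching_right hjC
      by_contra hle
      have hne : matching O C j ≠ i := fun e => hi (e ▸ h)
      have h1 := Nat.count_strict_mono (p := (· ∈ O)) h (show matching O C j < i by omega)
      have h2 := H.count_eq i (hij.trans (H.lt_right j hjC)) hi hiC
      have h3 := Nat.count_monotone (· ∈ C) hij.le
      omega
  · rw [matching_of_notMem hj hjC]
    have := H.lt_matching_iff.not.2 hi
    omega

lemma isInvolution321_matching (H : IsBallot n 0 O C) : IsInvolution321 n (matching O C) where
  invol := H.matching_matching
  fix a ha := matching_of_notMem (fun h => (H.lt_left a h).not_ge ha)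
    (fun h => (H.lt_right a h).not_ge ha)
  avoid i j k hij hjk h1 h2 := by
    -- An inversion has exactly one end in `O`, which is impossible for all three pairs of a 321
    -- pattern.
    have hO : ∀ {a b}, a < b → matching O C b < matching O C a → ¬(a ∈ O ↔ b ∈ O) := by
      intro a b hab h hiff
      by_cases ha : a ∈ O
      · exact (H.matching_lt_matching_of_mem hab ha (hiff.1 ha)).not_gt h
      · exact (H.matching_lt_matching_of_notMem hab ha (hiff.not.1 ha)).not_gt h
    have h3 := hO hij h1
    have h4 := hO hjk h2
    have h5 := hO (hij.trans hjk) (h2.trans h1)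
    tauto

lemma openers_matching (H : IsBallot n 0 O C) : openers n (matching O C) = O := by
  ext a
  rw [H.isInvolution321_matching.mem_openers, H.lt_matching_iff]

lemma closers_matching (H : IsBallot n 0 O C) : closers n (matching O C) = C := by
  ext a
  rw [H.isInvolution321_matching.mem_closers, H.matching_lt_iff]

end IsBallot

/-! ### Transfer to permutations of `Fin n`. -/

/-- The extension of a permutation of `Fin n` to `ℕ` by the identity. -/
def extend {n : ℕ} (π : Equiv.Perm (Fin n)) (a : ℕ) : ℕ := if h : a < n then π ⟨a, h⟩ else a

section extend

variable {n : ℕ} (π : Equiv.Perm (Fin n))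

@[simp] lemma extend_val (i : Fin n) : extend π i = π i := by simp [extend]

lemma extend_of_le {a : ℕ} (h : n ≤ a) : extend π a = a := by simp [extend, h]

lemma extend_injective : Function.Injective (extend (n := n)) := by
  intro π σ h
  ext i
  rw [← extend_val, h, extend_val]

lemma isInvolution321_extend_iff :
    IsInvolution321 n (extend π) ↔ π ∈ involutions321 n := by
  constructor
  · intro H
    refine ⟨?_, ?_⟩
    · rw [eq_inv_iff_mul_eq_one]
      ext i
      have := H.invol i
      simpa using this
    · rintro ⟨i, j, k, hij, hjk, h1, h2⟩
      exact H.avoid i j k hij hjk (by simpa using h1) (by simpa using h2)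
  · rintro ⟨hinv, havoid⟩
    have hlt : ∀ a < n, extend π a < n := fun a ha => by simp [extend, ha]
    refine ⟨fun a => ?_, fun a ha => extend_of_le π ha, fun i j k hij hjk h1 h2 => ?_⟩
    · rcases lt_or_ge a n with ha | ha
      · lift a to Fin n using ha
        rw [extend_val, extend_val]
        congr 1
        exact DFunLike.congr_fun (eq_inv_iff_mul_eq_one.1 hinv) a
      · rw [extend_of_le π ha, extend_of_le π ha]
    · have hj : j < n := by
        by_contra hj
        have := hlt i
        have := extend_of_le π (a := i)
        have := extend_of_le π (a := j)
        omega
      have hk : k < n := by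
        by_contra hk
        have := hlt j hj
        have := extend_of_le π (a := k)
        omega
      have hi : i < n := hij.trans hj
      lift i to Fin n using hi
      lift j to Fin n using hj
      lift k to Fin n using hk
      simp only [extend_val, Fin.val_fin_lt] at *
      exact havoid ⟨i, j, k, hij, hjk, h1, h2⟩

lemma maj_eq_sum_extend : maj π = ∑ i ∈ range n with extend π (i + 1) < extend π i, (i + 1) := by
  rw [maj, Des, sum_image (fun i _ j _ h => by simpa [Fin.ext_iff] using h)]
  refine sum_bij (fun i _ => (i : ℕ)) ?_ ?_ ?_ ?_
  · intro i hi
    simp only [mem_filter, mem_univ, true_and] at hi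
    obtain ⟨h, hi⟩ := hi
    simp only [mem_filter, mem_range, i.2, true_and, extend_val]
    simpa [extend, h] using hi
  · intro i _ j _ h
    exact Fin.ext h
  · intro a ha
    simp only [mem_filter, mem_range] at ha
    obtain ⟨ha, h⟩ := ha
    have h1 : a + 1 < n := by
      by_contra h1
      rw [extend_of_le π (by omega)] at h
      have : extend π a < n := by simp [extend, ha]
      omega
    refine ⟨⟨a, ha⟩, ?_, rfl⟩
    simp only [mem_filter, mem_univ, true_and]
    exact ⟨h1, by simpa [extend, ha, h1] using h⟩
  · intro _ _
    rfl

end extend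

lemma exists_extend_eq {n : ℕ} {f : ℕ → ℕ} (H : IsInvolution321 n f) :
    ∃ π : Equiv.Perm (Fin n), extend π = f := by
  refine ⟨Function.Involutive.toPerm (fun i => ⟨f i, H.map_lt i.2⟩) fun i => ?_, ?_⟩
  · simp [H.invol]
  · funext a
    rcases lt_or_ge a n with ha | ha
    · rw [extend, dif_pos ha]
      rfl
    · rw [extend_of_le _ ha, H.fix a ha]

lemma ncard_eq_card_ballots (n m : ℕ) :
    Set.ncard {π : Equiv.Perm (Fin n) | π ∈ involutions321 n ∧ maj π = m} =
      #{x ∈ ballots n 0 | peakSum x.1 x.2 = m} := by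
  rw [← Set.ncard_coe_finset]
  refine Set.ncard_congr (fun π _ => (openers n (extend π), closers n (extend π))) ?_ ?_ ?_
  · rintro π ⟨hπ, hm⟩
    have H := (isInvolution321_extend_iff π).2 hπ
    rw [mem_coe, mem_filter, mem_ballots, H.peakSum_eq, ← maj_eq_sum_extend]
    exact ⟨H.isBallot, hm⟩
  · rintro π σ ⟨hπ, -⟩ ⟨hσ, -⟩ h
    simp only [Prod.mk.injEq] at h
    exact extend_injective (((isInvolution321_extend_iff π).2 hπ).eq_of_openers_eq
      ((isInvolution321_extend_iff σ).2 hσ) h.1 h.2)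
  · intro x hx
    rw [mem_coe, mem_filter, mem_ballots] at hx
    obtain ⟨H, hm⟩ := hx
    obtain ⟨π, hπ⟩ := exists_extend_eq H.isInvolution321_matching
    have Hπ : IsInvolution321 n (extend π) := hπ ▸ H.isInvolution321_matching
    have e : (openers n (extend π), closers n (extend π)) = x := by
      rw [hπ, H.openers_matching, H.closers_matching]
    refine ⟨π, ⟨(isInvolution321_extend_iff π).1 Hπ, ?_⟩, e⟩
    rw [maj_eq_sum_extend, ← Hπ.peakSum_eq, hπ, H.openers_matching, H.closers_matching, hm]

lemma coeff_ballotGen (n h m : ℕ) :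
    (ballotGen n h).coeff m = #{x ∈ ballots n h | peakSum x.1 x.2 = m} := by
  simp [ballotGen, coeff_X_pow, eq_comm]

end PermStat

theorem mainTheorem9 (n m : ℕ) (hnm : 2 * m ≤ n) :
    Set.ncard {π : Equiv.Perm (Fin n) | π ∈ PermStat.involutions321 n ∧ PermStat.maj π = m} =
      Fintype.card (Nat.Partition m) := by
  have h := PermStat.coeff_ballotGen n 0 m
  rw [PermStat.ballotGen_eq_gauss n (n / 2) 0 (n % 2) (by omega) (by omega),
    PermStat.coeff_gauss_eq_card_partition (by omega) (by omega)] at h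
  rw [PermStat.ncard_eq_card_ballots]
  exact_mod_cast h.symm
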